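/- Let $k:\mathbf R^D\times\mathbf R^D\to\mathbf R$ be a bounded positive definite kernel that is analytic (for every $x$ the function $k(x,\cdot)$ is real analytic on $\mathbf R^D$) and characteristic (for probability measures $P,Q$ on $\mathbf R^D$, $\mathrm{MMD}(P,Q)=\sup_{\|f\|_{H_k}\le 1}\left[\int f\,dP-\int f\,dQ\right]$ vanishes if and only if $P=Q$, where $H_k$ is the reproducing kernel Hilbert space of $k$). Write $\mu_P(t)=\int k(x,t)\,dP(x)$. Let $J\ge 1$, let $T_1,\dots,T_J$ be i.i.d. test points in $\mathbf R^D$ whose distribution is absolutely continuous with respect to the Lebesgue measure, and let $$d_{\mu,J}^2(P,Q)=\frac1J\sum_{j=1}^J\big(\mu_P(T_j)-\mu_Q(T_j)\big)^2 .$$ Let $P,Q$ be probability measures on $\mathbf R^D$ that are not both concentrated on one common set of at most $J$ points. Let $X_1,X_2,\dots$ be i.i.d. from $P$ and $Y_1,Y_2,\dots$ i.i.d. from $Q$, the two samples being independent of each other; the test points live on a probability space $(\Omega_1,\mathbb P_1)$, the samples on a probability space $(\Omega_2,\mathbb P_2)$, and everything is considered on the product. Put $$Z_i=\big(k(X_i,T_1)-k(Y_i,T_1),\dots,k(X_i,T_J)-k(Y_i,T_J)\big)\in\mathbf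 R^J,$$ $$W_n=\frac1n\sum_{i=1}^n Z_i,\qquad \Sigma_n=\frac1n\sum_{i=1}^n Z_iZ_i^\top,\qquad S_n=n\,W_n^\top\Sigma_n^{-1}W_n,$$ with $S_n=0$ if $\Sigma_n$ is singular. Then, for $\mathbb P_1$-almost every realization of the test points, $\mathbb P_2(\Sigma_n\text{ is invertible})\to 1$ as $n\to\infty$. Moreover: 1. If $d_{\mu,J}^2(P,Q)=0$ a.s., then for $\mathbb P_1$-almost every realization of the test points, $S_n$ converges in distribution (under $\mathbb P_2$), as $n\to\infty$ with $J$ fixed, to a $\chi^2$ random variable with $J$ degrees of freedom. 2. If $d_{\mu,J}^2(P,Q)>0$ a.s., then for $\mathbb P_1$-almost every realization of the test points and every fixed $r\in\mathbf R$, $\mathbb P_2(S_n>r)\to 1$ as $n\to\infty$; that is, the test that rejects when $S_n$ exceeds a fixed threshold is consistent. -/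

import Mathlib

open MeasureTheory ProbabilityTheory Filter
open scoped Topology Matrix

/-- The scalar kernel `k`, seen as a matrix of operators on `ℝ` (the entry at `(x, y)` is
multiplication by `k x y`), as needed for Mathlib's construction of the RKHS of a kernel. -/
noncomputable def operatorKernel {E : Type*} (k : E → E → ℝ) : Matrix E E (ℝ →L[ℝ] ℝ) :=
  Matrix.of fun x y => k x y • ContinuousLinearMap.id ℝ ℝ

/-- `k` is a positive definite kernel (in the sense of the theory of RKHS): it is symmetric and
`∑ a, ∑ b, c a * c b * k a b ≥ 0` for all finitely supported real coefficients `c`. -/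
def IsPosDefKernel {E : Type*} (k : E → E → ℝ) : Prop :=
  (Matrix.of k).PosSemidef

theorem IsPosDefKernel.operatorKernel_posSemidef {E : Type*} {k : E → E → ℝ}
    (hk : IsPosDefKernel k) : (operatorKernel k).PosSemidef := by
  have tf : (operatorKernel k).PosSemidef ↔ (operatorKernel k).IsHermitian ∧ ∀ v : E →₀ ℝ,
      0 ≤ RCLike.re (v.sum fun x w ↦ v.sum fun x' w' ↦ inner ℝ (operatorKernel k x' x w) w') :=
    RKHS.posSemidef_tfae.out 0 2
  refine tf.mpr ⟨?_, fun v => ?_⟩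
  · ext x y
    have h := hk.isHermitian.apply x y
    simp only [Matrix.of_apply, star_trivial] at h
    have h_id : ContinuousLinearMap.adjoint (ContinuousLinearMap.id ℝ ℝ) =
        ContinuousLinearMap.id ℝ ℝ := star_one (ℝ →L[ℝ] ℝ)
    simp [operatorKernel, h, ContinuousLinearMap.star_eq_adjoint, h_id]
  · have h := hk.2 v
    simp only [Matrix.of_apply, star_trivial] at h
    rw [Finsupp.sum_comm]
    simpa [operatorKernel, mul_comm, mul_left_comm, mul_assoc] using h

/-- The maximum mean discrepancy `sup {∫ f dP - ∫ f dQ | f ∈ H_k, ‖f‖ ≤ 1}`, where `H_k` is the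
reproducing kernel Hilbert space with kernel `k`. -/
noncomputable def MMD {E : Type*} [MeasurableSpace E] (k : E → E → ℝ) (hk : IsPosDefKernel k)
    (P Q : Measure E) : EReal :=
  haveI : Fact (operatorKernel k).PosSemidef := ⟨hk.operatorKernel_posSemidef⟩
  ⨆ f : {f : RKHS.OfKernel (operatorKernel k) // ‖f‖ ≤ 1},
    (((∫ x, f.1 x ∂P) - ∫ x, f.1 x ∂Q : ℝ) : EReal)

/-- A positive definite kernel is characteristic when the maximum mean discrepancy separates
probability measures. -/
def IsCharacteristic {E : Type*} [MeasurableSpace E] (k : E → E → ℝ)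
    (hk : IsPosDefKernel k) : Prop :=
  ∀ P Q : Measure E, IsProbabilityMeasure P → IsProbabilityMeasure Q →
    (MMD k hk P Q = 0 ↔ P = Q)

/-- The kernel `k` is analytic: every feature map `k x` is real analytic. -/
def IsAnalyticKernel {E : Type*} [NormedAddCommGroup E] [NormedSpace ℝ E]
    (k : E → E → ℝ) : Prop :=
  ∀ x, AnalyticOnNhd ℝ (k x) Set.univ

/-- The mean embedding `μ_P(t) = ∫ k(x, t) dP(x)`. -/
noncomputable def meanEmbedding {E : Type*} [MeasurableSpace E] (k : E → E → ℝ)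
    (P : Measure E) (t : E) : ℝ :=
  ∫ x, k x t ∂P

/-- The squared distance `d²_{μ,J}(P, Q)` at the test points `t 0, …, t (J - 1)`. -/
noncomputable def meanEmbeddingDistSq {E : Type*} [MeasurableSpace E] {J : ℕ} (k : E → E → ℝ)
    (t : Fin J → E) (P Q : Measure E) : ℝ :=
  (1 / (J : ℝ)) * ∑ j, (meanEmbedding k P (t j) - meanEmbedding k Q (t j)) ^ 2

/-- The vector of kernel differences at the test points `t`, for the pair of observations
`x`, `y`. -/
def kernelDiff {E : Type*} {J : ℕ} (k : E → E → ℝ) (t : Fin J → E) (x y : E) : Fin J → ℝ :=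
  fun j => k x (t j) - k y (t j)

/-- The mean `W_n` of the first `n` difference vectors of the samples `x`, `y`. -/
noncomputable def meanDiff {E : Type*} {J : ℕ} (k : E → E → ℝ) (t : Fin J → E) (x y : ℕ → E)
    (n : ℕ) : Fin J → ℝ :=
  (1 / (n : ℝ)) • ∑ i ∈ Finset.range n, kernelDiff k t (x i) (y i)

/-- The matrix `Σ_n = (1/n) ∑ i < n, Z_i Z_iᵀ` of the difference vectors `Z_i`. -/
noncomputable def covDiff {E : Type*} {J : ℕ} (k : E → E → ℝ) (t : Fin J → E) (x y : ℕ → E)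
    (n : ℕ) : Matrix (Fin J) (Fin J) ℝ :=
  (1 / (n : ℝ)) • ∑ i ∈ Finset.range n,
    Matrix.vecMulVec (kernelDiff k t (x i) (y i)) (kernelDiff k t (x i) (y i))

/-- The statistic `S_n = n W_nᵀ Σ_n⁻¹ W_n` (which is `0` when `Σ_n` is singular, as Mathlib's
`Σ_n⁻¹` is then `0`). -/
noncomputable def hotellingStat {E : Type*} {J : ℕ} (k : E → E → ℝ) (t : Fin J → E)
    (x y : ℕ → E) (n : ℕ) : ℝ :=
  (n : ℝ) * (meanDiff k t x y n ⬝ᵥ ((covDiff k t x y n)⁻¹ *ᵥ meanDiff k t x y n))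

/-- The `χ²` distribution with `J` degrees of freedom: the law of the sum of the squares of `J`
independent standard normal variables. -/
noncomputable def chiSquared (J : ℕ) : Measure ℝ :=
  (Measure.pi fun _ : Fin J => gaussianReal 0 1).map fun x => ∑ j, x j ^ 2

instance chiSquared.isProbabilityMeasure (J : ℕ) : IsProbabilityMeasure (chiSquared J) :=
  Measure.isProbabilityMeasure_map (by
    have h : Measurable fun x : Fin J → ℝ => ∑ j, x j ^ 2 := by fun_prop
    exact h.aemeasurable)

/-! Fix the test points `t`. The vectors `Z i` are then i.i.d. and bounded, with mean `μ_P(t j) -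
μ_Q(t j)` in coordinate `j`. Once their second moment matrix `M` is positive definite, the rest is
classical. By the strong law `Σ_n → M`, so `Σ_n` is eventually invertible. If the mean is nonzero,
`W_nᵀ Σ_n⁻¹ W_n` has a positive limit and the factor `n` sends `S_n` to infinity. If it is zero, the
central limit theorem and Slutsky's lemma give the limit `vᵀ M⁻¹ v` with `v` Gaussian of covariance
`M`, which is `χ²`.

The core is therefore `ae_posDef_secondMoment_kernelDiff`. If `M` is degenerate along `c`, then `g =
∑ j, c j * k · (t j)` satisfies `g x = g y` for almost every pair, so by continuity `g` is constant
on the union of the supports. That union contains distinct points `x 0, …, x J`, so the `J × J`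
matrix with entries `k (x i) (t j) - k (x 0) (t j)`, `i ≥ 1`, kills `c`. For almost every `t` this
matrix is invertible: the characteristic property makes the functions `k (x i) - k (x 0)` linearly
independent, analyticity makes their nontrivial combinations nonzero almost everywhere, and an
induction on cofactors passes from combinations to the determinant. -/

/-! ### Zero sets of analytic functions and generic determinants -/

/-- A real analytic function of one real variable that is not identically zero has countably many
zeros. -/
theorem AnalyticOnNhd.countable_zeros {f : ℝ → ℝ} (hf : AnalyticOnNhd ℝ f Set.univ) {r₀ : ℝ}
    (h₀ : f r₀ ≠ 0) : {r | f r = 0}.Countable := by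
  have h : ∀ᶠ x in codiscreteWithin (Set.univ : Set ℝ), f x ≠ 0 :=
    (hf.eqOn_zero_or_eventually_ne_zero_of_preconnected isPreconnected_univ).resolve_left
      fun h => h₀ (h (Set.mem_univ r₀))
  have hd : IsDiscrete ({r | f r = 0} ∩ Set.univ) := by
    refine isDiscrete_of_codiscreteWithin (U := Set.univ) ?_
    filter_upwards [h] with x hx using hx
  -- A subspace of `ℝ` is separable, and a separable discrete space is countable.
  rw [Set.inter_univ] at hd
  have := hd.to_subtype
  exact Set.countable_coe_iff.mp (TopologicalSpace.separableSpace_iff_countable.mp inferInstance)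

/-- The zero set of a real analytic function on a finite-dimensional space that is not identically
zero is a null set. -/
theorem AnalyticOnNhd.ae_ne_zero {E : Type*} [NormedAddCommGroup E] [NormedSpace ℝ E]
    [FiniteDimensional ℝ E] [MeasurableSpace E] [BorelSpace E] (μ : Measure E) [μ.IsAddHaarMeasure]
    {f : E → ℝ} (hf : AnalyticOnNhd ℝ f Set.univ) {x₀ : E} (h₀ : f x₀ ≠ 0) :
    ∀ᵐ x ∂μ, f x ≠ 0 := by
  have hfc : Continuous f := continuousOn_univ.mp hf.continuousOn
  -- along almost every dilation centred at `x₀`, almost every point is not a zero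
  have h1 : ∀ x, ∀ᵐ r : ℝ, f (x₀ + r • (x - x₀)) ≠ 0 := by
    intro x
    have hg : AnalyticOnNhd ℝ (fun r : ℝ => f (x₀ + r • (x - x₀))) Set.univ := by
      intro r _
      have h2 : AnalyticAt ℝ (fun r : ℝ => x₀ + r • (x - x₀)) r := by fun_prop
      exact AnalyticAt.fun_comp (hf _ (Set.mem_univ _)) h2
    have := hg.countable_zeros (r₀ := 0) (by simpa using h₀)
    simpa [ae_iff] using this.measure_zero volume
  have hmeas : MeasurableSet {p : E × ℝ | f (x₀ + p.2 • (p.1 - x₀)) ≠ 0} :=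
    (isOpen_ne_fun (by fun_prop) continuous_const).measurableSet
  -- Fubini turns "for every `x`, almost every `r`" into "for almost every `r`, almost every `x`",
  -- so a single nonzero dilation factor `r` can be chosen.
  have h2 : ∀ᵐ p ∂(μ.prod (volume : Measure ℝ)), f (x₀ + p.2 • (p.1 - x₀)) ≠ 0 :=
    (Measure.ae_prod_iff_ae_ae hmeas).mpr (ae_of_all _ h1)
  have hmeas' : MeasurableSet {p : ℝ × E | f (x₀ + p.1 • (p.2 - x₀)) ≠ 0} :=
    (isOpen_ne_fun (by fun_prop) continuous_const).measurableSet
  have h3 : ∀ᵐ p ∂((volume : Measure ℝ).prod μ), f (x₀ + p.1 • (p.2 - x₀)) ≠ 0 := by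
    rw [← Measure.prod_swap, ae_map_iff measurable_swap.aemeasurable hmeas']
    exact h2
  have h4 : ∀ᵐ r : ℝ, ∀ᵐ x ∂μ, f (x₀ + r • (x - x₀)) ≠ 0 := Measure.ae_ae_of_ae_prod h3
  have h5 : ∀ᵐ r : ℝ, r ≠ 0 := by simp [ae_iff]
  obtain ⟨r, hr, hr0⟩ := (h4.and h5).exists
  -- undo the dilation
  have hq : Measure.QuasiMeasurePreserving (fun y : E => x₀ + r⁻¹ • (y - x₀)) μ μ := by
    have e1 : Measure.QuasiMeasurePreserving (fun y : E => y - x₀) μ μ :=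
      (measurePreserving_sub_right μ x₀).quasiMeasurePreserving
    have e2 : Measure.QuasiMeasurePreserving (fun y : E => r⁻¹ • y) μ μ := by
      refine ⟨by fun_prop, ?_⟩
      rw [Measure.map_addHaar_smul μ (inv_ne_zero hr0)]
      exact Measure.smul_absolutelyContinuous
    have e3 : Measure.QuasiMeasurePreserving (fun y : E => x₀ + y) μ μ :=
      (measurePreserving_add_left μ x₀).quasiMeasurePreserving
    exact e3.comp (e2.comp e1)
  filter_upwards [hq.ae hr] with y hy
  simpa [smul_smul, mul_inv_cancel₀ hr0] using hy

/-- If `h 0, …, h (J - 1)` are linearly independent functions, all of whose nontrivial combinations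
are `ν`-almost everywhere nonzero, then the matrix `h i (t j)` is invertible for almost every choice
of points `t j`. -/
theorem ae_det_ne_zero_of_linearIndependent {E : Type*} [MeasurableSpace E] (ν : Measure E)
    [SigmaFinite ν] {J : ℕ} (h : Fin J → E → ℝ) (hm : ∀ i, Measurable (h i))
    (hh : ∀ c : Fin J → ℝ, c ≠ 0 → ∀ᵐ x ∂ν, ∑ i, c i * h i x ≠ 0) :
    ∀ᵐ t ∂(Measure.pi fun _ : Fin J => ν), (Matrix.of fun i j => h i (t j)).det ≠ 0 := by
  induction J with
  | zero => simp
  | succ n ih =>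
    have hdm : Measurable fun t : Fin (n + 1) → E => (Matrix.of fun i j => h i (t j)).det := by
      simp only [Matrix.det_apply, Matrix.of_apply]
      fun_prop
    -- Padding `c` with a zero coefficient transfers the hypothesis to the first `n` functions.
    have ih' := ih (fun i => h i.castSucc) (fun i => hm _) (fun c hc => by
      have hc' : (Fin.snoc c 0 : Fin (n + 1) → ℝ) ≠ 0 := by
        intro h0
        apply hc
        funext i
        have := congrFun h0 i.castSucc
        simpa using this
      filter_upwards [hh _ hc'] with x hx
      simpa [Fin.sum_univ_castSucc] using hx)
    have hmp := measurePreserving_piFinSuccAbove (fun _ : Fin (n + 1) => ν) 0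
    have key : ∀ᵐ p ∂(ν.prod (Measure.pi fun _ : Fin n => ν)),
        (Matrix.of fun i j => h i ((MeasurableEquiv.piFinSuccAbove (fun _ => E) 0).symm p j)).det
          ≠ 0 := by
      have hms : MeasurableSet {p : E × (Fin n → E) | (Matrix.of fun i j =>
          h i ((MeasurableEquiv.piFinSuccAbove (fun _ => E) 0).symm p j)).det ≠ 0} :=
        (hdm.comp (MeasurableEquiv.measurable _)) (measurableSet_singleton 0).compl
      have hms' : MeasurableSet {p : (Fin n → E) × E | (Matrix.of fun i j =>
          h i ((MeasurableEquiv.piFinSuccAbove (fun _ => E) 0).symm p.swap j)).det ≠ 0} :=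
        measurable_swap hms
      rw [← Measure.prod_swap, ae_map_iff measurable_swap.aemeasurable hms]
      refine (Measure.ae_prod_iff_ae_ae hms').mpr ?_
      filter_upwards [ih'] with s hs
      -- With the other points `s` fixed, the determinant is a combination of the `h i x` whose
      -- coefficients are the cofactors of column `0`. The last cofactor is, up to sign, the
      -- determinant from the induction hypothesis, so the combination is nontrivial.
      have hc : (fun i : Fin (n + 1) => (-1) ^ (i : ℕ) *
          (Matrix.of fun (a b : Fin n) => h (i.succAbove a) (s b)).det) ≠ 0 := by
        intro h0
        apply hs
        have := congrFun h0 (Fin.last n)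
        simpa [Fin.succAbove_last] using this
      filter_upwards [hh _ hc] with x hx
      rw [Matrix.det_succ_column_zero]
      convert hx using 2
      rename_i i _
      exact mul_right_comm ((-1 : ℝ) ^ (i : ℕ)) (h i x) _
    have := hmp.quasiMeasurePreserving.ae key
    simpa using this

/-! ### Linear relations between kernel functions -/

theorem IsPosDefKernel.symm {E : Type*} {k : E → E → ℝ} (hk : IsPosDefKernel k) (x y : E) :
    k x y = k y x := by
  simpa using hk.isHermitian.apply y x

/-- A relation between the functions `k (x i)` is satisfied by the values at the points `x i` of
every element of the RKHS with kernel `k`. -/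
theorem IsPosDefKernel.sum_mul_apply_eq_zero {E ι : Type*} [Fintype ι] {k : E → E → ℝ}
    (hk : IsPosDefKernel k) [Fact (operatorKernel k).PosSemidef] {x : ι → E} {b : ι → ℝ}
    (hb : ∀ t, ∑ i, b i * k (x i) t = 0) (f : RKHS.OfKernel (operatorKernel k)) :
    ∑ i, b i * f (x i) = 0 := by
  let H := RKHS.OfKernel (operatorKernel k)
  have hg : ∑ i, b i • RKHS.kerFun H (x i) (1 : ℝ) = 0 := by
    ext y
    have h1 : (∑ i, b i • RKHS.kerFun H (x i) (1 : ℝ)) y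
        = ∑ i, b i * (RKHS.kerFun H (x i) (1 : ℝ)) y := by
      rw [← RKHS.coeCLM_apply (𝕜 := ℝ), map_sum, Finset.sum_apply]
      simp
    rw [h1, RKHS.coe_zero, Pi.zero_apply, ← hb y]
    refine Finset.sum_congr rfl fun i _ => ?_
    rw [RKHS.kerFun_apply, RKHS.OfKernel.kernel_ofKernel, hk.symm]
    simp [operatorKernel]
  -- The reproducing property: pairing `f` with the vanishing combination evaluates `f` at the
  -- points.
  have h2 : inner ℝ f (∑ i, b i • RKHS.kerFun H (x i) (1 : ℝ)) = ∑ i, b i * f (x i) := by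
    rw [inner_sum]
    refine Finset.sum_congr rfl fun i _ => ?_
    rw [inner_smul_right, RKHS.inner_kerFun]
    simp
  rw [← h2, hg, inner_zero_right]

/-- The integral against a finitely supported measure with nonnegative weights `w`. -/
theorem integral_sum_ofReal_smul_dirac {E ι : Type*} [MeasurableSpace E]
    [MeasurableSingletonClass E] [Fintype ι] {w : ι → ℝ} (hw : ∀ i, 0 ≤ w i) (x : ι → E)
    (f : E → ℝ) :
    ∫ y, f y ∂(∑ i, ENNReal.ofReal (w i) • Measure.dirac (x i)) = ∑ i, w i * f (x i) := by
  rw [integral_finsetSum_measure]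
  · refine Finset.sum_congr rfl fun i _ => ?_
    rw [integral_smul_measure, integral_dirac, ENNReal.toReal_ofReal (hw i), smul_eq_mul]
  · intro i _
    exact (integrable_dirac (by simp [enorm_lt_top])).smul_measure ENNReal.ofReal_ne_top

theorem isProbabilityMeasure_sum_ofReal_smul_dirac {E ι : Type*} [MeasurableSpace E]
    [Fintype ι] {w : ι → ℝ} (hw : ∀ i, 0 ≤ w i) (hw1 : ∑ i, w i = 1) (x : ι → E) :
    IsProbabilityMeasure (∑ i, ENNReal.ofReal (w i) • Measure.dirac (x i)) := by
  constructor
  simp [← ENNReal.ofReal_sum_of_nonneg fun i _ => hw i, hw1]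

theorem sum_ofReal_smul_dirac_singleton {E ι : Type*} [MeasurableSpace E]
    [MeasurableSingletonClass E] [Fintype ι] (w : ι → ℝ) {x : ι → E} (hx : Function.Injective x)
    (i : ι) :
    (∑ i, ENNReal.ofReal (w i) • Measure.dirac (x i)) {x i} = ENNReal.ofReal (w i) := by
  classical
  rw [Measure.finsetSum_apply, Finset.sum_eq_single i]
  · simp
  · intro j _ hj
    simp [hx.ne hj]
  · simp

/-- For a characteristic kernel, the functions `k (x i)` at distinct points satisfy no nontrivial
linear relation with coefficients of total mass zero. -/
theorem IsCharacteristic.eq_zero_of_sum_mul_eq_zero {E ι : Type*} [MeasurableSpace E]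
    [MeasurableSingletonClass E] [Fintype ι] {k : E → E → ℝ} {hk : IsPosDefKernel k}
    (hchar : IsCharacteristic k hk) {x : ι → E} (hx : Function.Injective x) {b : ι → ℝ}
    (hb0 : ∑ i, b i = 0) (hb : ∀ t, ∑ i, b i * k (x i) t = 0) : b = 0 := by
  rcases isEmpty_or_nonempty ι with hι | hι
  · exact Subsingleton.elim _ _
  have hN : (0 : ℝ) < Fintype.card ι := by exact_mod_cast Fintype.card_pos
  -- `M` bounds every `|b i|`, which keeps the weights `w'` nonnegative; the summand `1` keeps it
  -- positive when `b = 0`. Perturbing the uniform weights along `b` preserves total mass because `∑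
  -- i, b i = 0`.
  set M : ℝ := 1 + ∑ i, |b i| with hM
  have hbM : ∀ i, |b i| ≤ M := fun i =>
    (Finset.single_le_sum (fun j _ => abs_nonneg (b j)) (Finset.mem_univ i)).trans (by linarith)
  have hMpos : 0 < M := by positivity
  set w : ι → ℝ := fun _ => (Fintype.card ι : ℝ)⁻¹ with hw
  set w' : ι → ℝ := fun i => (Fintype.card ι : ℝ)⁻¹ * (1 + b i / M) with hw'
  have hw0 : ∀ i, 0 ≤ w i := fun i => by positivity
  have hw'0 : ∀ i, 0 ≤ w' i := fun i => by
    have : -1 ≤ b i / M := by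
      rw [le_div_iff₀ hMpos]
      linarith [neg_abs_le (b i), hbM i]
    exact mul_nonneg (by positivity) (by linarith)
  have hw1 : ∑ i, w i = 1 := by simp [hw]
  have hw'1 : ∑ i, w' i = 1 := by
    simp only [hw', ← Finset.mul_sum, Finset.sum_add_distrib, ← Finset.sum_div, hb0]
    simp
  have hmmd : MMD k hk (∑ i, ENNReal.ofReal (w i) • Measure.dirac (x i))
      (∑ i, ENNReal.ofReal (w' i) • Measure.dirac (x i)) = 0 := by
    have : Fact (operatorKernel k).PosSemidef := ⟨hk.operatorKernel_posSemidef⟩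
    have hzero : ∀ f : {f : RKHS.OfKernel (operatorKernel k) // ‖f‖ ≤ 1},
        (((∫ y, f.1 y ∂(∑ i, ENNReal.ofReal (w i) • Measure.dirac (x i)))
          - ∫ y, f.1 y ∂(∑ i, ENNReal.ofReal (w' i) • Measure.dirac (x i)) : ℝ) : EReal) = 0 := by
      intro f
      rw [integral_sum_ofReal_smul_dirac hw0, integral_sum_ofReal_smul_dirac hw'0,
        ← Finset.sum_sub_distrib]
      have : ∀ i, w i * f.1 (x i) - w' i * f.1 (x i)
          = -((Fintype.card ι : ℝ)⁻¹ / M) * (b i * f.1 (x i)) := fun i => by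
        simp only [hw, hw']; ring
      simp only [this, ← Finset.mul_sum, hk.sum_mul_apply_eq_zero hb f.1, mul_zero, EReal.coe_zero]
    -- Over an empty index the supremum in `EReal` would be `⊥` instead of `0`.
    have : Nonempty {f : RKHS.OfKernel (operatorKernel k) // ‖f‖ ≤ 1} := ⟨⟨0, by simp⟩⟩
    unfold MMD
    simp only [hzero, ciSup_const]
  have heq := (hchar _ _ (isProbabilityMeasure_sum_ofReal_smul_dirac hw0 hw1 x)
    (isProbabilityMeasure_sum_ofReal_smul_dirac hw'0 hw'1 x)).mp hmmd
  funext i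
  have h1 := congrArg (fun m : Measure E => m {x i}) heq
  simp only [sum_ofReal_smul_dirac_singleton _ hx] at h1
  rw [ENNReal.ofReal_eq_ofReal_iff (hw0 i) (hw'0 i)] at h1
  have h2 : (Fintype.card ι : ℝ)⁻¹ * (b i / M) = 0 := by
    simp only [hw, hw'] at h1; linarith
  simpa [hN.ne', hMpos.ne'] using h2

/-! ### Supports -/

/-- If two measures are not both carried by one set of at most `J` points, the union of their
supports contains `J + 1` distinct points. -/
theorem exists_injective_mem_support {E : Type*} [TopologicalSpace E] [HereditarilyLindelofSpace E]
    [MeasurableSpace E] {J : ℕ} {P Q : Measure E}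
    (hPQ : ¬ ∃ s : Finset E, s.card ≤ J ∧ P (s : Set E)ᶜ = 0 ∧ Q (s : Set E)ᶜ = 0) :
    ∃ x : Fin (J + 1) → E, Function.Injective x ∧ ∀ i, x i ∈ P.support ∪ Q.support := by
  by_cases hS : ((J + 1 : ℕ) : ℕ∞) ≤ (P.support ∪ Q.support).encard
  · obtain ⟨t, ht, htc⟩ := Set.exists_subset_encard_eq hS
    have htf : t.Finite := Set.finite_of_encard_eq_coe htc
    have hcard : htf.toFinset.card = J + 1 := by
      rw [htf.encard_eq_coe_toFinset_card] at htc
      exact_mod_cast htc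
    refine ⟨fun i => (htf.toFinset.equivFinOfCardEq hcard).symm i, ?_, fun i => ?_⟩
    · exact Subtype.val_injective.comp (Equiv.injective _)
    · exact ht (htf.mem_toFinset.mp ((htf.toFinset.equivFinOfCardEq hcard).symm i).2)
  · exfalso
    push Not at hS
    -- With at most `J` points, the union of the supports would itself carry both measures.
    have hf : (P.support ∪ Q.support).Finite := Set.finite_of_encard_le_coe hS.le
    refine hPQ ⟨hf.toFinset, ?_, ?_, ?_⟩
    · rw [hf.encard_eq_coe_toFinset_card] at hS
      have : hf.toFinset.card < J + 1 := by exact_mod_cast hS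
      omega
    · refine measure_mono_null ?_ P.measure_compl_support
      simp
    · refine measure_mono_null ?_ Q.measure_compl_support
      simp

/-- A continuous function `g` with `g x = g y` for almost every `(x, y)` is constant on the
union of the supports. -/
theorem eq_of_ae_prod_eq {E F : Type*} [TopologicalSpace E] [HereditarilyLindelofSpace E]
    [MeasurableSpace E] [TopologicalSpace F] [T2Space F] {P Q : Measure E} [SFinite Q]
    (hP : P ≠ 0) (hQ : Q ≠ 0) {g : E → F} (hg : Continuous g)
    (h : ∀ᵐ p ∂(P.prod Q), g p.1 = g p.2) {x y : E} (hx : x ∈ P.support ∪ Q.support)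
    (hy : y ∈ P.support ∪ Q.support) : g x = g y := by
  have key : ∀ a ∈ P.support, ∀ b ∈ Q.support, g a = g b := by
    intro a ha b hb
    by_contra hab
    have hopen : IsOpen {p : E × E | g p.1 ≠ g p.2} :=
      isOpen_ne_fun (hg.comp continuous_fst) (hg.comp continuous_snd)
    obtain ⟨U, hU, V, hV, hUV⟩ := mem_nhds_prod_iff.mp (hopen.mem_nhds (x := (a, b)) hab)
    have h0 : (P.prod Q) (U ×ˢ V) = 0 := measure_mono_null hUV (ae_iff.mp h)
    rw [Measure.prod_prod, mul_eq_zero] at h0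
    rcases h0 with h0 | h0
    · exact (Measure.mem_support_iff_forall a |>.mp ha U hU).ne' h0
    · exact (Measure.mem_support_iff_forall b |>.mp hb V hV).ne' h0
  -- Two points of the same support are compared through a point of the other one.
  obtain ⟨a, ha⟩ := Measure.nonempty_support hP
  obtain ⟨b, hb⟩ := Measure.nonempty_support hQ
  have all : ∀ z ∈ P.support ∪ Q.support, g z = g b := by
    rintro z (hz | hz)
    · exact key z hz b hb
    · rw [← key a ha z hz, key a ha b hb]
  rw [all x hx, all y hy]

/-! ### Second moment matrices -/

/-- The matrix of second moments of a random vector. -/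
noncomputable def secondMoment {Ω : Type*} [MeasurableSpace Ω] {J : ℕ} (μ : Measure Ω)
    (Z : Ω → Fin J → ℝ) : Matrix (Fin J) (Fin J) ℝ :=
  Matrix.of fun a b => ∫ ω, Z ω a * Z ω b ∂μ

/-- Expanding the square shows that degeneracy along `c` amounts to `c ⬝ᵥ Z = 0` almost surely; the
same identity gives the variance of a centred projection in the central limit theorem. -/
theorem dotProduct_secondMoment_mulVec {Ω : Type*} [MeasurableSpace Ω] {J : ℕ} {μ : Measure Ω}
    {Z : Ω → Fin J → ℝ} (hZ : ∀ a, MemLp (fun ω => Z ω a) 2 μ) (c : Fin J → ℝ) :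
    c ⬝ᵥ secondMoment μ Z *ᵥ c = ∫ ω, (c ⬝ᵥ Z ω) ^ 2 ∂μ := by
  have hint : ∀ a b, Integrable (fun ω => Z ω a * Z ω b) μ := fun a b =>
    (hZ a).integrable_mul (hZ b)
  have h1 : ∀ ω, (c ⬝ᵥ Z ω) ^ 2 = ∑ a, ∑ b, c a * c b * (Z ω a * Z ω b) := by
    intro ω
    rw [sq, dotProduct, Finset.sum_mul_sum]
    exact Finset.sum_congr rfl fun a _ => Finset.sum_congr rfl fun b _ => by ring
  simp_rw [h1]
  rw [integral_finsetSum _ fun a _ => integrable_finsetSum _ fun b _ => (hint a b).const_mul _]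
  simp only [dotProduct, Matrix.mulVec, secondMoment, Matrix.of_apply, Finset.mul_sum]
  refine Finset.sum_congr rfl fun a _ => ?_
  rw [integral_finsetSum _ fun b _ => (hint a b).const_mul _]
  refine Finset.sum_congr rfl fun b _ => ?_
  rw [integral_const_mul]
  ring

theorem secondMoment_isHermitian {Ω : Type*} [MeasurableSpace Ω] {J : ℕ} (μ : Measure Ω)
    (Z : Ω → Fin J → ℝ) : (secondMoment μ Z).IsHermitian := by
  ext a b
  simp [secondMoment, mul_comm]

/-- The second moment matrix is positive definite unless some nontrivial linear combination of the
coordinates vanishes almost surely. -/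
theorem secondMoment_posDef {Ω : Type*} [MeasurableSpace Ω] {J : ℕ} {μ : Measure Ω}
    {Z : Ω → Fin J → ℝ} (hZ : ∀ a, MemLp (fun ω => Z ω a) 2 μ)
    (h : ∀ c : Fin J → ℝ, (∀ᵐ ω ∂μ, c ⬝ᵥ Z ω = 0) → c = 0) : (secondMoment μ Z).PosDef := by
  refine Matrix.PosDef.of_dotProduct_mulVec_pos (secondMoment_isHermitian μ Z) fun c hc => ?_
  rw [star_trivial, dotProduct_secondMoment_mulVec hZ]
  have hint : Integrable (fun ω => (c ⬝ᵥ Z ω) ^ 2) μ := by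
    have : MemLp (fun ω => c ⬝ᵥ Z ω) 2 μ := by
      simp only [dotProduct]
      exact memLp_finsetSum _ fun a _ => (hZ a).const_mul _
    exact this.integrable_sq
  refine lt_of_le_of_ne (integral_nonneg fun ω => sq_nonneg _) fun h0 => hc (h c ?_)
  have := (integral_eq_zero_iff_of_nonneg (fun ω => sq_nonneg (c ⬝ᵥ Z ω)) hint).mp h0.symm
  filter_upwards [this] with ω hω
  simpa using hω

/-! ### Kernel differences at generic test points -/

theorem IsAnalyticKernel.continuous_right {E : Type*} [NormedAddCommGroup E] [NormedSpace ℝ E]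
    {k : E → E → ℝ} (hk_an : IsAnalyticKernel k) (x : E) : Continuous (k x) :=
  continuousOn_univ.mp (hk_an x).continuousOn

theorem IsAnalyticKernel.continuous_left {E : Type*} [NormedAddCommGroup E] [NormedSpace ℝ E]
    {k : E → E → ℝ} (hk_an : IsAnalyticKernel k) (hk : IsPosDefKernel k) (t : E) :
    Continuous fun x => k x t := by
  simpa only [hk.symm _ t] using hk_an.continuous_right t

section KernelDiff

variable {E : Type*} [NormedAddCommGroup E] [NormedSpace ℝ E] {k : E → E → ℝ}

theorem continuous_kernelDiff (hk : IsPosDefKernel k) (hk_an : IsAnalyticKernel k) {J : ℕ}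
    (t : Fin J → E) : Continuous fun p : E × E => kernelDiff k t p.1 p.2 := by
  refine continuous_pi fun j => ?_
  exact ((hk_an.continuous_left hk (t j)).comp continuous_fst).sub
    ((hk_an.continuous_left hk (t j)).comp continuous_snd)

variable [MeasurableSpace E] [BorelSpace E]

theorem memLp_kernelDiff [SecondCountableTopology E] (hk : IsPosDefKernel k)
    (hk_bdd : ∃ C : ℝ, ∀ x y, |k x y| ≤ C)
    (hk_an : IsAnalyticKernel k) {J : ℕ} (t : Fin J → E) (ρ : Measure (E × E)) [IsFiniteMeasure ρ]
    (j : Fin J) : MemLp (fun p : E × E => kernelDiff k t p.1 p.2 j) 2 ρ := by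
  obtain ⟨C, hC⟩ := hk_bdd
  have hc : Continuous fun p : E × E => kernelDiff k t p.1 p.2 j :=
    (continuous_apply j).comp (continuous_kernelDiff hk hk_an t)
  refine MemLp.of_bound hc.aestronglyMeasurable (C + C) (ae_of_all _ fun p => ?_)
  exact (abs_sub _ _).trans (add_le_add (hC _ _) (hC _ _))

/-- The second moment matrix of the kernel differences is positive definite for almost every choice
of the test points. -/
theorem ae_posDef_secondMoment_kernelDiff [FiniteDimensional ℝ E] {ρ : Measure E}
    [ρ.IsAddHaarMeasure] (hk : IsPosDefKernel k)
    (hk_bdd : ∃ C : ℝ, ∀ x y, |k x y| ≤ C) (hk_an : IsAnalyticKernel k)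
    (hk_char : IsCharacteristic k hk) {J : ℕ} {P Q : Measure E} [IsProbabilityMeasure P]
    [IsProbabilityMeasure Q]
    (hPQ : ¬ ∃ s : Finset E, s.card ≤ J ∧ P (s : Set E)ᶜ = 0 ∧ Q (s : Set E)ᶜ = 0)
    {ν : Measure E} [SigmaFinite ν] (hν : ν ≪ ρ) :
    ∀ᵐ t ∂(Measure.pi fun _ : Fin J => ν),
      (secondMoment (P.prod Q) fun p => kernelDiff k t p.1 p.2).PosDef := by
  have : ProperSpace E := FiniteDimensional.proper ℝ E
  obtain ⟨x, hx, hxs⟩ := exists_injective_mem_support hPQ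
  have hdet := ae_det_ne_zero_of_linearIndependent ν
    (fun (i : Fin J) t => k (x i.succ) t - k (x 0) t)
    (fun i => ((hk_an.continuous_right _).sub (hk_an.continuous_right _)).measurable)
    (fun c hc => by
      have han : AnalyticOnNhd ℝ (fun t => ∑ i, c i * (k (x i.succ) t - k (x 0) t)) Set.univ :=
        Finset.analyticOnNhd_fun_sum _ fun i _ =>
          analyticOnNhd_const.mul ((hk_an _).sub (hk_an _))
      obtain ⟨t₀, ht₀⟩ : ∃ t₀, ∑ i, c i * (k (x i.succ) t₀ - k (x 0) t₀) ≠ 0 := by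
        by_contra! hall
        have hb := hk_char.eq_zero_of_sum_mul_eq_zero hx
          -- Subtracting `k (x 0)` gives `x 0` the weight `-∑ i, c i`, so the total mass is zero, as
          -- the characteristic property requires.
          (b := Fin.cons (-∑ i, c i) c) (by simp [Fin.sum_univ_succ]) (fun t => by
            rw [← hall t]
            simp only [Fin.sum_univ_succ, Fin.cons_zero, Fin.cons_succ, mul_sub,
              Finset.sum_sub_distrib, Finset.sum_mul, neg_mul]
            ring)
        exact hc (funext fun i => by simpa using congrFun hb i.succ)
      exact hν.ae_le (han.ae_ne_zero ρ ht₀))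
  filter_upwards [hdet] with t ht
  refine secondMoment_posDef (memLp_kernelDiff hk hk_bdd hk_an t _) fun c hc => ?_
  set g : E → ℝ := fun z => ∑ j, c j * k z (t j) with hg
  have hgc : Continuous g :=
    continuous_finsetSum _ fun j _ => continuous_const.mul (hk_an.continuous_left hk (t j))
  have hae : ∀ᵐ p ∂(P.prod Q), g p.1 = g p.2 := by
    filter_upwards [hc] with p hp
    simp only [dotProduct, kernelDiff, mul_sub, Finset.sum_sub_distrib] at hp
    exact sub_eq_zero.mp hp
  -- Row `i` of the matrix applied to `c` is `g (x i.succ) - g (x 0)`, which vanishes since `g` is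
  -- constant on the supports.
  refine Matrix.eq_zero_of_mulVec_eq_zero ht (funext fun i => ?_)
  have := eq_of_ae_prod_eq (IsProbabilityMeasure.ne_zero P) (IsProbabilityMeasure.ne_zero Q) hgc hae
    (hxs i.succ) (hxs 0)
  simp only [Matrix.mulVec, dotProduct, Matrix.of_apply, Pi.zero_apply, sub_mul,
    Finset.sum_sub_distrib]
  rw [sub_eq_zero]
  simpa only [hg, mul_comm] using this

end KernelDiff

/-! ### Laws of large numbers and consistency -/

/-- If `p n` holds eventually, almost surely, then its probability tends to one. -/
theorem tendsto_measure_of_ae_eventually {Ω : Type*} [MeasurableSpace Ω] {μ : Measure Ω}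
    [IsProbabilityMeasure μ] {p : ℕ → Ω → Prop} (h : ∀ᵐ ω ∂μ, ∀ᶠ n in atTop, p n ω) :
    Tendsto (fun n => μ {ω | p n ω}) atTop (𝓝 1) := by
  have hmono : Monotone fun N : ℕ => {ω | ∀ n ≥ N, p n ω} :=
    fun N M hNM ω hω n hn => hω n (hNM.trans hn)
  have h1 : μ (⋃ N : ℕ, {ω | ∀ n ≥ N, p n ω}) = 1 := by
    refine (measure_congr ?_).trans measure_univ
    rw [ae_eq_univ]
    refine measure_mono_null ?_ (ae_iff.mp h)
    intro ω hω
    simpa [eventually_atTop] using hω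
  have h2 := tendsto_measure_iUnion_atTop (μ := μ) hmono
  rw [h1] at h2
  exact tendsto_of_tendsto_of_tendsto_of_le_of_le h2 tendsto_const_nhds
    (fun N => measure_mono fun ω hω => hω N le_rfl) (fun N => prob_le_one)

section Matrix

variable {J : ℕ}

/-- Cramer's formula: the inverse is the adjugate divided by the determinant, and both are
continuous. -/
theorem Matrix.tendsto_inv {α : Type*} {l : Filter α} {M : α → Matrix (Fin J) (Fin J) ℝ}
    {S : Matrix (Fin J) (Fin J) ℝ} (hS : S.det ≠ 0) (h : Tendsto M l (𝓝 S)) :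
    Tendsto (fun n => (M n)⁻¹) l (𝓝 S⁻¹) := by
  simp only [Matrix.inv_def, Ring.inverse_eq_inv']
  refine Tendsto.smul (Tendsto.inv₀ ?_ hS) ?_
  · exact ((continuous_id.matrix_det).tendsto S).comp h
  · exact ((continuous_id.matrix_adjugate).tendsto S).comp h

theorem Matrix.measurable_inv_apply (a b : Fin J) :
    Measurable fun M : Fin J → Fin J → ℝ => (Matrix.of M)⁻¹ a b := by
  simp only [Matrix.inv_def, Ring.inverse_eq_inv', Matrix.smul_apply, smul_eq_mul]
  have h0 : Continuous fun M : Fin J → Fin J → ℝ => Matrix.of M := continuous_id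
  exact h0.matrix_det.measurable.inv.mul
    ((continuous_apply_apply a b).comp h0.matrix_adjugate).measurable

end Matrix

section Empirical

variable {J : ℕ}

/-- The mean of the first `n` terms of a sequence of vectors. -/
noncomputable def empiricalMean (z : ℕ → Fin J → ℝ) (n : ℕ) : Fin J → ℝ :=
  (1 / (n : ℝ)) • ∑ i ∈ Finset.range n, z i

/-- The second moment matrix of the first `n` terms of a sequence of vectors. -/
noncomputable def empiricalSecondMoment (z : ℕ → Fin J → ℝ) (n : ℕ) :
    Matrix (Fin J) (Fin J) ℝ :=
  (1 / (n : ℝ)) • ∑ i ∈ Finset.range n, Matrix.vecMulVec (z i) (z i)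

theorem empiricalMean_apply (z : ℕ → Fin J → ℝ) (n : ℕ) (a : Fin J) :
    empiricalMean z n a = (∑ i ∈ Finset.range n, z i a) / n := by
  simp [empiricalMean, div_eq_inv_mul]

theorem empiricalSecondMoment_apply (z : ℕ → Fin J → ℝ) (n : ℕ) (a b : Fin J) :
    empiricalSecondMoment z n a b = (∑ i ∈ Finset.range n, z i a * z i b) / n := by
  simp [empiricalSecondMoment, Matrix.sum_apply, Matrix.vecMulVec_apply, div_eq_inv_mul]

variable {Ω : Type*} [MeasurableSpace Ω] {μ : Measure Ω}
  {Z : ℕ → Ω → Fin J → ℝ}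

theorem ae_tendsto_empiricalSecondMoment (hindep : iIndepFun Z μ)
    (hident : ∀ i, IdentDistrib (Z i) (Z 0) μ μ) (hL2 : ∀ a, MemLp (fun ω => Z 0 ω a) 2 μ) :
    ∀ᵐ ω ∂μ, Tendsto (empiricalSecondMoment fun i => Z i ω) atTop (𝓝 (secondMoment μ (Z 0))) := by
  have hm : ∀ a b : Fin J, Measurable fun z : Fin J → ℝ => z a * z b := fun a b => by fun_prop
  have h : ∀ a b, ∀ᵐ ω ∂μ, Tendsto (fun n : ℕ => (∑ i ∈ Finset.range n, Z i ω a * Z i ω b) / n)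
      atTop (𝓝 (∫ ω, Z 0 ω a * Z 0 ω b ∂μ)) := fun a b =>
    strong_law_ae_real (fun i ω => Z i ω a * Z i ω b) ((hL2 a).integrable_mul (hL2 b))
      (fun i j hij => (hindep.indepFun hij).comp (hm a b) (hm a b))
      (fun i => (hident i).comp (hm a b))
  filter_upwards [ae_all_iff.mpr fun a => ae_all_iff.mpr (h a)] with ω hω
  refine tendsto_pi_nhds.mpr fun a => tendsto_pi_nhds.mpr fun b => ?_
  simp only [empiricalSecondMoment_apply]
  exact hω a b

variable [IsProbabilityMeasure μ]

theorem ae_tendsto_empiricalMean (hindep : iIndepFun Z μ)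
    (hident : ∀ i, IdentDistrib (Z i) (Z 0) μ μ) (hL2 : ∀ a, MemLp (fun ω => Z 0 ω a) 2 μ) :
    ∀ᵐ ω ∂μ, Tendsto (empiricalMean fun i => Z i ω) atTop (𝓝 fun a => ∫ ω, Z 0 ω a ∂μ) := by
  have h : ∀ a, ∀ᵐ ω ∂μ, Tendsto (fun n : ℕ => (∑ i ∈ Finset.range n, Z i ω a) / n) atTop
      (𝓝 (∫ ω, Z 0 ω a ∂μ)) := fun a =>
    strong_law_ae_real (fun i ω => Z i ω a) ((hL2 a).integrable (by norm_num))
      (fun i j hij => (hindep.indepFun hij).comp (measurable_pi_apply a) (measurable_pi_apply a))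
      (fun i => (hident i).comp (measurable_pi_apply a))
  filter_upwards [ae_all_iff.mpr h] with ω hω
  refine tendsto_pi_nhds.mpr fun a => ?_
  simpa only [empiricalMean_apply] using hω a

/-- The empirical second moment matrix of an i.i.d. sequence whose second moment matrix is positive
definite is invertible with probability tending to one. -/
theorem tendsto_measure_isUnit_det_empiricalSecondMoment (hindep : iIndepFun Z μ)
    (hident : ∀ i, IdentDistrib (Z i) (Z 0) μ μ) (hL2 : ∀ a, MemLp (fun ω => Z 0 ω a) 2 μ)
    (hpos : (secondMoment μ (Z 0)).PosDef) :
    Tendsto (fun n => μ {ω | IsUnit (empiricalSecondMoment (fun i => Z i ω) n).det}) atTop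
      (𝓝 1) := by
  refine tendsto_measure_of_ae_eventually ?_
  filter_upwards [ae_tendsto_empiricalSecondMoment hindep hident hL2] with ω hω
  have h1 := ((continuous_id.matrix_det).tendsto (secondMoment μ (Z 0))).comp hω
  filter_upwards [h1.eventually_ne hpos.det_pos.ne'] with n hn
  exact isUnit_iff_ne_zero.mpr hn

/-- If the mean does not vanish, Hotelling's statistic exceeds every fixed threshold with
probability tending to one. -/
theorem tendsto_measure_lt_hotelling (hindep : iIndepFun Z μ)
    (hident : ∀ i, IdentDistrib (Z i) (Z 0) μ μ) (hL2 : ∀ a, MemLp (fun ω => Z 0 ω a) 2 μ)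
    (hpos : (secondMoment μ (Z 0)).PosDef) (hmean : (fun a => ∫ ω, Z 0 ω a ∂μ) ≠ 0) (r : ℝ) :
    Tendsto (fun n : ℕ => μ {ω | r < (n : ℝ) * (empiricalMean (fun i => Z i ω) n ⬝ᵥ
      (empiricalSecondMoment (fun i => Z i ω) n)⁻¹ *ᵥ empiricalMean (fun i => Z i ω) n)}) atTop
      (𝓝 1) := by
  refine tendsto_measure_of_ae_eventually ?_
  filter_upwards [ae_tendsto_empiricalSecondMoment hindep hident hL2,
    ae_tendsto_empiricalMean hindep hident hL2] with ω hω hω'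
  have h1 := Matrix.tendsto_inv hpos.det_pos.ne' hω
  have h2 : Tendsto (fun n => empiricalMean (fun i => Z i ω) n ⬝ᵥ
      (empiricalSecondMoment (fun i => Z i ω) n)⁻¹ *ᵥ empiricalMean (fun i => Z i ω) n) atTop
      (𝓝 ((fun a => ∫ ω, Z 0 ω a ∂μ) ⬝ᵥ
        (secondMoment μ (Z 0))⁻¹ *ᵥ fun a => ∫ ω, Z 0 ω a ∂μ)) := by
    have hc : Continuous fun p : (Fin J → ℝ) × Matrix (Fin J) (Fin J) ℝ => p.1 ⬝ᵥ p.2 *ᵥ p.1 :=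
      continuous_fst.dotProduct (continuous_snd.matrix_mulVec continuous_fst)
    exact (hc.tendsto (_, _)).comp (hω'.prodMk_nhds h1)
  have h3 := hpos.inv.dotProduct_mulVec_pos hmean
  rw [star_trivial] at h3
  -- The quadratic form has the positive limit `h3`, so its product with `n` diverges.
  exact (tendsto_natCast_atTop_atTop.atTop_mul_pos h3 h2).eventually_gt_atTop r

end Empirical

/-! ### Central limit theorem and the `χ²` limit -/

section CentralLimit

variable {J : ℕ} {Ω : Type*} [MeasurableSpace Ω] {μ : Measure Ω} [IsProbabilityMeasure μ]
  {Z : ℕ → Ω → Fin J → ℝ}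

theorem sqrt_smul_empiricalMean (z : ℕ → Fin J → ℝ) (n : ℕ) :
    √(n : ℝ) • empiricalMean z n = (√(n : ℝ))⁻¹ • ∑ i ∈ Finset.range n, z i := by
  rw [empiricalMean, smul_smul, mul_one_div, Real.sqrt_div_self]

/-- The **central limit theorem** for centred i.i.d. random vectors. -/
theorem tendstoInDistribution_sqrt_smul_empiricalMean (hindep : iIndepFun Z μ)
    (hident : ∀ i, IdentDistrib (Z i) (Z 0) μ μ) (hL2 : ∀ a, MemLp (fun ω => Z 0 ω a) 2 μ)
    (hpos : (secondMoment μ (Z 0)).PosSemidef) (hmean : ∀ a, ∫ ω, Z 0 ω a ∂μ = 0) :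
    TendstoInDistribution
      (fun (n : ℕ) ω => WithLp.toLp 2 (√(n : ℝ) • empiricalMean (fun i => Z i ω) n)) atTop
      (id : EuclideanSpace ℝ (Fin J) → EuclideanSpace ℝ (Fin J)) (fun _ => μ)
      (multivariateGaussian 0 (secondMoment μ (Z 0))) := by
  have hZm : ∀ i, AEMeasurable (Z i) μ := fun i => (hident i).aemeasurable_fst
  have hVm : ∀ n : ℕ, AEMeasurable
      (fun ω => WithLp.toLp 2 (√(n : ℝ) • empiricalMean (fun i => Z i ω) n)) μ := by
    intro n
    simp only [empiricalMean]
    fun_prop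
  refine ⟨hVm, aemeasurable_id, ProbabilityMeasure.tendsto_iff_tendsto_charFun.mpr fun t => ?_⟩
  -- project on the direction `t`
  set U : ℕ → Ω → ℝ := fun i ω => t.ofLp ⬝ᵥ Z i ω with hU
  have hproj : Measurable fun z : Fin J → ℝ => t.ofLp ⬝ᵥ z := by
    simp only [dotProduct]
    fun_prop
  have hUL2 : MemLp (U 0) 2 μ := by
    simp only [hU, dotProduct]
    exact memLp_finsetSum _ fun a _ => (hL2 a).const_mul _
  have hU0 : μ[U 0] = 0 := by
    simp only [hU, dotProduct]
    rw [integral_finsetSum _ fun a _ => ((hL2 a).integrable (by norm_num)).const_mul _]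
    simp [integral_const_mul, hmean]
  have hvar : Var[U 0; μ] = t.ofLp ⬝ᵥ secondMoment μ (Z 0) *ᵥ t.ofLp := by
    rw [variance_of_integral_eq_zero hUL2.aemeasurable hU0, dotProduct_secondMoment_mulVec hL2]
  have hclt := tendstoInDistribution_inv_sqrt_mul_sum_sub (P := μ) (X := U)
    (P' := gaussianReal 0 Var[U 0; μ].toNNReal) (Y := id) HasLaw.id hUL2
    (hindep.comp (fun _ z => t.ofLp ⬝ᵥ z) fun _ => hproj) (fun i => (hident i).comp hproj)
  -- Cramér–Wold: the characteristic function of a vector at `t` is that of its projection on `t` at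
  -- frequency `1`.
  have hch := ProbabilityMeasure.tendsto_iff_tendsto_charFun.mp hclt.tendsto 1
  have hlim : charFun ((gaussianReal 0 Var[U 0; μ].toNNReal).map id) 1
      = charFun ((multivariateGaussian 0 (secondMoment μ (Z 0))).map id) t := by
    rw [Measure.map_id, Measure.map_id, charFun_gaussianReal, charFun_multivariateGaussian hpos,
      ← hvar]
    simp [Real.coe_toNNReal _ (variance_nonneg _ _)]
  simp only [ProbabilityMeasure.coe_mk] at hch ⊢
  rw [← hlim]
  refine hch.congr fun n => ?_
  have hUm : AEMeasurable (fun ω => (√(n : ℝ))⁻¹ * (∑ i ∈ Finset.range n, U i ω - n * μ[U 0])) μ :=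
    hclt.forall_aemeasurable n
  rw [charFun_apply_real, charFun_apply, integral_map hUm (by fun_prop),
    integral_map (hVm n) (by fun_prop)]
  refine integral_congr_ae (ae_of_all _ fun ω => ?_)
  have h1 : inner ℝ (WithLp.toLp 2 (√(n : ℝ) • empiricalMean (fun i => Z i ω) n)) t
      = (√(n : ℝ))⁻¹ * ∑ i ∈ Finset.range n, U i ω := by
    rw [EuclideanSpace.inner_eq_star_dotProduct, star_trivial, sqrt_smul_empiricalMean,
      dotProduct_smul, smul_eq_mul]
    simp only [hU, dotProduct_sum]
  simp only [h1, hU0, mul_zero, sub_zero, Complex.ofReal_one, one_mul]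

open scoped MatrixOrder in
/-- For a centred Gaussian vector `v` with invertible covariance matrix `S`, the quadratic form
`vᵀ S⁻¹ v` follows a `χ²` distribution. -/
theorem map_multivariateGaussian_eq_chiSquared {S : Matrix (Fin J) (Fin J) ℝ} (hS : S.PosDef) :
    (multivariateGaussian 0 S).map (fun v => v.ofLp ⬝ᵥ S⁻¹ *ᵥ v.ofLp) = chiSquared J := by
  have hm : Measurable fun v : EuclideanSpace ℝ (Fin J) => v.ofLp ⬝ᵥ S⁻¹ *ᵥ v.ofLp := by
    simp only [dotProduct, Matrix.mulVec]
    fun_prop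
  rw [multivariateGaussian, ← map_pi_eq_stdGaussian, Measure.map_map hm (by fun_prop),
    Measure.map_map (by fun_prop) (by fun_prop), chiSquared]
  congr 1
  funext x
  have hsq : CFC.sqrt S * CFC.sqrt S = S := CFC.sqrt_mul_sqrt_self _ hS.posSemidef.nonneg
  have hsym : (CFC.sqrt S)ᵀ = CFC.sqrt S := by
    have := (CFC.sqrt_nonneg S).isSelfAdjoint.star_eq
    rwa [Matrix.star_eq_conjTranspose, Matrix.conjTranspose_eq_transpose_of_trivial] at this
  have hunit : IsUnit (CFC.sqrt S).det := by
    have h1 : (CFC.sqrt S).det * (CFC.sqrt S).det = S.det := by rw [← Matrix.det_mul, hsq]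
    refine isUnit_iff_ne_zero.mpr fun h0 => hS.det_pos.ne' ?_
    rw [← h1, h0, zero_mul]
  set A := CFC.sqrt S with hA
  -- The Gaussian vector is `A` applied to a standard one, so by this identity the quadratic form
  -- pulls back to the sum of squares.
  have hone : A * S⁻¹ * A = 1 := by
    rw [← hsq, Matrix.mul_inv_rev, ← Matrix.mul_assoc, Matrix.mul_nonsing_inv _ hunit,
      Matrix.one_mul, Matrix.nonsing_inv_mul _ hunit]
  simp only [Function.comp_apply, zero_add, Matrix.ofLp_toEuclideanCLM]
  calc (A *ᵥ x) ⬝ᵥ S⁻¹ *ᵥ (A *ᵥ x) = (x ᵥ* Aᵀ) ⬝ᵥ S⁻¹ *ᵥ (A *ᵥ x) := by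
        rw [Matrix.vecMul_transpose]
    _ = x ⬝ᵥ (A * S⁻¹ * A) *ᵥ x := by
        rw [hsym, ← Matrix.dotProduct_mulVec, Matrix.mulVec_mulVec, Matrix.mulVec_mulVec,
          Matrix.mul_assoc]
    _ = ∑ j, x j ^ 2 := by
        rw [hone, Matrix.one_mulVec, dotProduct]
        exact Finset.sum_congr rfl fun j _ => (sq _).symm

/-- If the mean vanishes, Hotelling's statistic converges in distribution to a `χ²` random
variable. -/
theorem tendstoInDistribution_hotelling (hindep : iIndepFun Z μ)
    (hident : ∀ i, IdentDistrib (Z i) (Z 0) μ μ) (hL2 : ∀ a, MemLp (fun ω => Z 0 ω a) 2 μ)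
    (hpos : (secondMoment μ (Z 0)).PosDef) (hmean : ∀ a, ∫ ω, Z 0 ω a ∂μ = 0) :
    TendstoInDistribution (fun (n : ℕ) ω => (n : ℝ) * (empiricalMean (fun i => Z i ω) n ⬝ᵥ
      (empiricalSecondMoment (fun i => Z i ω) n)⁻¹ *ᵥ empiricalMean (fun i => Z i ω) n)) atTop
      (id : ℝ → ℝ) (fun _ => μ) (chiSquared J) := by
  have hZm : ∀ i, AEMeasurable (Z i) μ := fun i => (hident i).aemeasurable_fst
  set N : ℕ → Ω → Fin J → Fin J → ℝ := fun n ω a b =>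
    (empiricalSecondMoment (fun i => Z i ω) n)⁻¹ a b with hN
  have hNm : ∀ n, AEMeasurable (N n) μ := by
    intro n
    refine aemeasurable_pi_lambda _ fun a => aemeasurable_pi_lambda _ fun b => ?_
    have hM : AEMeasurable
        (fun ω => fun a b => empiricalSecondMoment (fun i => Z i ω) n a b) μ := by
      simp only [empiricalSecondMoment_apply]
      fun_prop
    exact (Matrix.measurable_inv_apply a b).comp_aemeasurable hM
  have hNlim : TendstoInMeasure μ N atTop fun _ a b => (secondMoment μ (Z 0))⁻¹ a b := by
    refine tendstoInMeasure_of_tendsto_ae (fun n => (hNm n).aestronglyMeasurable) ?_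
    filter_upwards [ae_tendsto_empiricalSecondMoment hindep hident hL2] with ω hω
    exact Matrix.tendsto_inv hpos.det_pos.ne' hω
  have hclt := tendstoInDistribution_sqrt_smul_empiricalMean hindep hident hL2 hpos.posSemidef hmean
  have hg : Continuous fun p : EuclideanSpace ℝ (Fin J) × (Fin J → Fin J → ℝ) =>
      p.1.ofLp ⬝ᵥ Matrix.of p.2 *ᵥ p.1.ofLp := by
    simp only [dotProduct, Matrix.mulVec, Matrix.of_apply]
    fun_prop
  -- Slutsky: the scaled mean converges in law and the inverse matrix in measure to a constant, so a
  -- continuous function of the pair converges in law. The factor `n` is split as `√n * √n` between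
  -- the two copies of the mean.
  have hslut := hclt.continuous_comp_prodMk_of_tendstoInMeasure_const hg hNlim hNm
  have hstat : ∀ (n : ℕ) ω, (√(n : ℝ) • empiricalMean (fun i => Z i ω) n) ⬝ᵥ
        Matrix.of (N n ω) *ᵥ (√(n : ℝ) • empiricalMean (fun i => Z i ω) n) =
      (n : ℝ) * (empiricalMean (fun i => Z i ω) n ⬝ᵥ
        (empiricalSecondMoment (fun i => Z i ω) n)⁻¹ *ᵥ empiricalMean (fun i => Z i ω) n) := by
    intro n ω
    have hof : Matrix.of (N n ω) = (empiricalSecondMoment (fun i => Z i ω) n)⁻¹ := rfl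
    rw [hof, Matrix.mulVec_smul, dotProduct_smul, smul_dotProduct, smul_eq_mul, smul_eq_mul,
      ← mul_assoc, Real.mul_self_sqrt (Nat.cast_nonneg n)]
  have hlaw : (chiSquared J).map id = (multivariateGaussian 0 (secondMoment μ (Z 0))).map
      fun v => v.ofLp ⬝ᵥ (secondMoment μ (Z 0))⁻¹ *ᵥ v.ofLp := by
    rw [Measure.map_id, map_multivariateGaussian_eq_chiSquared hpos]
  refine TendstoInDistribution.congr (fun n => ae_of_all _ (hstat n)) EventuallyEq.rfl ?_
  refine ⟨hslut.forall_aemeasurable, aemeasurable_id, ?_⟩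
  have h1 := hslut.tendsto
  convert h1 using 2
  exact congrArg 𝓝 (Subtype.ext hlaw)

end CentralLimit

/-! ### Independence of pairs -/

/-- Preimages of measurable rectangles form a π-system generating the σ-algebra of each pair, and on
rectangles the product formula reduces to that of the joint family. -/
theorem ProbabilityTheory.iIndepFun.prodMk_sumElim_of_measurable {Ω ι α : Type*}
    [MeasurableSpace Ω] [MeasurableSpace α] {μ : Measure Ω}
    {X Y : ι → Ω → α} (hX : ∀ i, Measurable (X i)) (hY : ∀ i, Measurable (Y i))
    (h : iIndepFun (Sum.elim X Y) μ) : iIndepFun (fun i ω => (X i ω, Y i ω)) μ := by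
  classical
  refine iIndepSets.iIndep (fun i => ((hX i).prodMk (hY i)).comap_le)
    (fun i => {s | ∃ t ∈ Set.image2 (· ×ˢ ·) {u : Set α | MeasurableSet u} {v | MeasurableSet v},
      (fun ω => (X i ω, Y i ω)) ⁻¹' t = s})
    (fun i => isPiSystem_prod.comap _) (fun i => ?_) ?_
  · rw [← generateFrom_prod, MeasurableSpace.comap_generateFrom]
    rfl
  · rw [iIndepSets_iff]
    intro S f hf
    simp only [Set.mem_ofPred_eq, Set.mem_image2] at hf
    choose! t ht hft using hf
    choose! u hu v hv huv using ht
    rw [iIndepFun_iff_measure_inter_preimage_eq_mul] at h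
    have hone : ∀ i ∈ S, f i = X i ⁻¹' u i ∩ Y i ⁻¹' v i := fun i hi => by
      rw [← hft i hi, ← huv i hi, Set.mk_preimage_prod]
    have hpair : ∀ i ∈ S, μ (f i) = μ (X i ⁻¹' u i) * μ (Y i ⁻¹' v i) := fun i hi => by
      have := h {Sum.inl i, Sum.inr i} (sets := Sum.elim u v) (by
        rintro j hj
        simp only [Finset.mem_insert, Finset.mem_singleton] at hj
        rcases hj with rfl | rfl
        · exact hu i hi
        · exact hv i hi)
      rw [Finset.prod_pair (by simp)] at this
      simpa [hone i hi] using this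
    -- The joint formula over two copies of `S` factors the intersection; `hpair` regroups its
    -- factors by index.
    have hall := h (S.disjSum S) (sets := Sum.elim u v) (by
      rintro (j | j) hj
      · exact hu j (by simpa using hj)
      · exact hv j (by simpa using hj))
    rw [Finset.prod_disjSum] at hall
    rw [Finset.prod_congr rfl hpair, Finset.prod_mul_distrib]
    refine Eq.trans ?_ hall
    congr 1
    ext ω
    simp only [Set.mem_iInter]
    constructor
    · rintro hω (j | j) hj
      · have hj' : j ∈ S := by simpa using hj
        have := hω j hj'
        rw [hone j hj'] at this
        exact this.1
      · have hj' : j ∈ S := by simpa using hj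
        have := hω j hj'
        rw [hone j hj'] at this
        exact this.2
    · intro hω j hj
      rw [hone j hj]
      exact ⟨hω (Sum.inl j) (by simpa using hj), hω (Sum.inr j) (by simpa using hj)⟩

/-- If all the members of two families are independent, then so are the pairs `(X i, Y i)`. -/
theorem ProbabilityTheory.iIndepFun.prodMk_sumElim {Ω ι α : Type*}
    [MeasurableSpace Ω] [MeasurableSpace α] {μ : Measure Ω}
    {X Y : ι → Ω → α} (hX : ∀ i, AEMeasurable (X i) μ) (hY : ∀ i, AEMeasurable (Y i) μ)
    (h : iIndepFun (Sum.elim X Y) μ) : iIndepFun (fun i ω => (X i ω, Y i ω)) μ := by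
  have h' : iIndepFun (Sum.elim (fun i => (hX i).mk) (fun i => (hY i).mk)) μ := by
    refine h.congr ?_
    rintro (i | i)
    · exact (hX i).ae_eq_mk
    · exact (hY i).ae_eq_mk
  refine (h'.prodMk_sumElim_of_measurable (fun i => (hX i).measurable_mk)
    (fun i => (hY i).measurable_mk)).congr fun i => ?_
  filter_upwards [(hX i).ae_eq_mk, (hY i).ae_eq_mk] with ω h1 h2
  rw [h1, h2]

/-! ### Assembly -/

theorem secondMoment_map {Ω Ω' : Type*} [MeasurableSpace Ω] [MeasurableSpace Ω'] {J : ℕ}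
    {μ : Measure Ω} {f : Ω → Ω'} (hf : AEMeasurable f μ) {Z : Ω' → Fin J → ℝ} (hZ : Measurable Z) :
    secondMoment (μ.map f) Z = secondMoment μ fun ω => Z (f ω) := by
  ext a b
  simp only [secondMoment, Matrix.of_apply]
  exact integral_map hf (by fun_prop)

theorem proposition2 {D J : ℕ} (hJ : 0 < J)
    -- the kernel
    (k : EuclideanSpace ℝ (Fin D) → EuclideanSpace ℝ (Fin D) → ℝ)
    (hk : IsPosDefKernel k) (hk_bdd : ∃ C : ℝ, ∀ x y, |k x y| ≤ C)
    (hk_an : IsAnalyticKernel k) (hk_char : IsCharacteristic k hk)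
    -- the two distributions, not both carried by one set of at most `J` points
    (P Q : Measure (EuclideanSpace ℝ (Fin D))) [IsProbabilityMeasure P] [IsProbabilityMeasure Q]
    (hPQ : ¬ ∃ s : Finset (EuclideanSpace ℝ (Fin D)),
      s.card ≤ J ∧ P (s : Set (EuclideanSpace ℝ (Fin D)))ᶜ = 0 ∧
        Q (s : Set (EuclideanSpace ℝ (Fin D)))ᶜ = 0)
    -- the random test points, i.i.d. with an absolutely continuous law
    {Ω₁ : Type*} [MeasurableSpace Ω₁] (μ₁ : Measure Ω₁) [IsProbabilityMeasure μ₁]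
    (ν : Measure (EuclideanSpace ℝ (Fin D))) (hν : ν ≪ volume)
    (T : Fin J → Ω₁ → EuclideanSpace ℝ (Fin D))
    (hT : ∀ j, HasLaw (T j) ν μ₁) (hT_indep : iIndepFun T μ₁)
    -- the two independent i.i.d. samples
    {Ω₂ : Type*} [MeasurableSpace Ω₂] (μ₂ : Measure Ω₂) [IsProbabilityMeasure μ₂]
    (X Y : ℕ → Ω₂ → EuclideanSpace ℝ (Fin D))
    (hX : ∀ i, HasLaw (X i) P μ₂) (hY : ∀ i, HasLaw (Y i) Q μ₂)
    (hXY_indep : iIndepFun (Sum.elim X Y) μ₂) :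
    -- the matrix to be inverted is invertible with probability tending to one
    (∀ᵐ ω ∂μ₁, Tendsto
      (fun n => μ₂ {ω' | IsUnit
        (covDiff k (fun j => T j ω) (fun i => X i ω') (fun i => Y i ω') n).det})
      atTop (𝓝 1)) ∧
    -- the null case
    ((∀ᵐ ω ∂μ₁, meanEmbeddingDistSq k (fun j => T j ω) P Q = 0) →
      ∀ᵐ ω ∂μ₁, TendstoInDistribution
        (fun n ω' => hotellingStat k (fun j => T j ω) (fun i => X i ω') (fun i => Y i ω') n)
        atTop (id : ℝ → ℝ) (fun _ => μ₂) (chiSquared J)) ∧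
    -- the alternative
    ((∀ᵐ ω ∂μ₁, 0 < meanEmbeddingDistSq k (fun j => T j ω) P Q) →
      ∀ᵐ ω ∂μ₁, ∀ r : ℝ, Tendsto
        (fun n => μ₂ {ω' | r <
          hotellingStat k (fun j => T j ω) (fun i => X i ω') (fun i => Y i ω') n})
        atTop (𝓝 1)) := by
  have hν_prob : IsProbabilityMeasure ν := (hT ⟨0, hJ⟩).isProbabilityMeasure_iff.mp inferInstance
  have hTlaw : HasLaw (fun ω j => T j ω) (Measure.pi fun _ : Fin J => ν) μ₁ := hT_indep.hasLaw_pi hT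
  -- almost surely, the second moment matrix at the test points is positive definite
  have hpd : ∀ᵐ ω ∂μ₁, (secondMoment (P.prod Q)
      fun p => kernelDiff k (fun j => T j ω) p.1 p.2).PosDef := by
    have h := ae_posDef_secondMoment_kernelDiff hk hk_bdd hk_an hk_char hPQ hν
    rw [← hTlaw.map_eq] at h
    exact ae_of_ae_map hTlaw.aemeasurable h
  -- the pairs of observations are i.i.d.
  have hXY : ∀ i, HasLaw (fun ω => (X i ω, Y i ω)) (P.prod Q) μ₂ := fun i =>
    (indepFun_iff_hasLaw_prodMk_prod (hX i) (hY i)).mp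
      (hXY_indep.indepFun (i := Sum.inl i) (j := Sum.inr i) (by simp))
  have hpairs : iIndepFun (fun i ω => (X i ω, Y i ω)) μ₂ :=
    hXY_indep.prodMk_sumElim (fun i => (hX i).aemeasurable) fun i => (hY i).aemeasurable
  set Z : (Fin J → EuclideanSpace ℝ (Fin D)) → ℕ → Ω₂ → Fin J → ℝ :=
    fun t i ω => kernelDiff k t (X i ω) (Y i ω) with hZ
  have hdm : ∀ t : Fin J → EuclideanSpace ℝ (Fin D), Measurable
      fun p : EuclideanSpace ℝ (Fin D) × EuclideanSpace ℝ (Fin D) => kernelDiff k t p.1 p.2 :=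
    fun t => (continuous_kernelDiff hk hk_an t).measurable
  have hindep : ∀ t, iIndepFun (Z t) μ₂ := fun t => hpairs.comp _ fun _ => hdm t
  have hident : ∀ t i, IdentDistrib (Z t i) (Z t 0) μ₂ μ₂ := fun t i =>
    IdentDistrib.comp (f := fun ω => (X i ω, Y i ω)) (g := fun ω => (X 0 ω, Y 0 ω))
      ⟨(hXY i).aemeasurable, (hXY 0).aemeasurable, by rw [(hXY i).map_eq, (hXY 0).map_eq]⟩ (hdm t)
  have hL2 : ∀ t a, MemLp (fun ω => Z t 0 ω a) 2 μ₂ := fun t a => by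
    have h := memLp_kernelDiff hk hk_bdd hk_an t (P.prod Q) a
    rw [← (hXY 0).map_eq] at h
    exact h.comp_of_map (hXY 0).aemeasurable
  have hsec : ∀ t, secondMoment μ₂ (Z t 0) =
      secondMoment (P.prod Q) fun p => kernelDiff k t p.1 p.2 := fun t => by
    rw [← (hXY 0).map_eq, secondMoment_map (hXY 0).aemeasurable (hdm t)]
  have hint : ∀ (R : Measure (EuclideanSpace ℝ (Fin D))) [IsProbabilityMeasure R] s,
      Integrable (fun x => k x s) R := fun R _ s => by
    obtain ⟨C, hC⟩ := hk_bdd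
    exact Integrable.of_bound (hk_an.continuous_left hk s).aestronglyMeasurable C
      (ae_of_all _ fun x => hC x s)
  have hmean : ∀ t a, ∫ ω, Z t 0 ω a ∂μ₂ = meanEmbedding k P (t a) - meanEmbedding k Q (t a) := by
    intro t a
    simp only [hZ, kernelDiff, meanEmbedding]
    have hPi := hint P (t a)
    have hQi := hint Q (t a)
    rw [← (hX 0).map_eq] at hPi
    rw [← (hY 0).map_eq] at hQi
    refine (integral_sub (hPi.comp_aemeasurable (hX 0).aemeasurable)
      (hQi.comp_aemeasurable (hY 0).aemeasurable)).trans ?_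
    congr 1
    · exact (hX 0).integral_comp (hk_an.continuous_left hk (t a)).aestronglyMeasurable
    · exact (hY 0).integral_comp (hk_an.continuous_left hk (t a)).aestronglyMeasurable
  refine ⟨?_, fun h0 => ?_, fun h1 => ?_⟩
  · filter_upwards [hpd] with ω hω
    rw [← hsec] at hω
    -- `covDiff` at fixed test points unfolds to `empiricalSecondMoment` of the sequence `Z`.
    exact tendsto_measure_isUnit_det_empiricalSecondMoment (hindep _) (hident _) (hL2 _) hω
  · filter_upwards [hpd, h0] with ω hω hd
    rw [← hsec] at hω
    refine tendstoInDistribution_hotelling (hindep _) (hident _) (hL2 _) hω fun a => ?_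
    rw [hmean]
    have hJ' : (1 / (J : ℝ)) ≠ 0 := by positivity
    -- A vanishing sum of squares forces every coordinate of the mean to vanish.
    have hsum := (mul_eq_zero.mp hd).resolve_left hJ'
    rw [Finset.sum_eq_zero_iff_of_nonneg fun j _ => sq_nonneg _] at hsum
    exact pow_eq_zero_iff two_ne_zero |>.mp (hsum a (Finset.mem_univ a))
  · filter_upwards [hpd, h1] with ω hω hd r
    rw [← hsec] at hω
    refine tendsto_measure_lt_hotelling (hindep _) (hident _) (hL2 _) hω (fun hz => ?_) r
    refine hd.ne' ?_
    have hz' : ∀ a, meanEmbedding k P (T a ω) - meanEmbedding k Q (T a ω) = 0 := fun a => by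
      rw [← hmean fun j => T j ω]
      exact congrFun hz a
    simp [meanEmbeddingDistSq, hz']
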